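/- Let $\mathcal L=\{\ell_i\}$ be a chord diagram: finitely many straight chords of the closed unit disk $D\subset\mathbb R^2$ with pairwise distinct endpoints on $\partial D$. Its incidence graph has the chords as vertices, two distinct chords being joined by an edge when they meet. An ordering $\sigma:\mathcal L\to\{1,\dots,n\}$ (a bijection) makes it a directed graph, in which every edge points to the chord of larger index. View $D$ as the unit disk of the $x,y$-plane in $\mathbb R^3\subset S^3=\mathbb R^3\cup\{\infty\}$. For an ordering $\sigma$ let $\Sigma_{\mathcal L,\sigma}\subset S^3$ be the surface obtained from $D$ by plumbing, for each chord $\ell$, a band $\eta_\ell$ with one full twist, the handedness of the twist being fixed once for all bands (in particular, all twists may be positive). The band $\eta_\ell$ is attached to $D$ along two small arcs of $\partial D$ around the endpoints of $\ell$, and it runs above $D$ over a thin strip around $\ell$. The bands are attached in the order $\sigma$, that is, wherever two of them cross, the band of the chord with larger index lies over the other one. Here the bands have a fixed width, so small that the closed attaching arcs of $\partial D$ are pairwise disjoint, and the band of index $k$ lies over the point $x\in D$ between the heights $(1-|x|^2)(k-\tfrac14)$ and $(1-|x|^2)(k+\tfrac14)$. Let $K_{\mathcal L,\sigma}=\partial\Sigma_{\mathcal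 L,\sigma}$ be the resulting fibered link, with fiber $\Sigma_{\mathcal L,\sigma}$. Lemma. If two orderings $\sigma,\tau$ of the chords of $\mathcal L$ give the same directed incidence graph on the vertex set $\mathcal L$, then the resulting fibered links are the same: for every such width there is an ambient isotopy of $S^3$ whose final homeomorphism carries $\Sigma_{\mathcal L,\sigma}$ onto $\Sigma_{\mathcal L,\tau}$ and $K_{\mathcal L,\sigma}$ onto $K_{\mathcal L,\tau}$ and fixes $D$ pointwise (so that it preserves the orientations of the fibers that extend that of $D$, and the boundary orientations of the links). -/

import Mathlib

noncomputable section

/-- The 3-sphere, as the one-point compactification of `ℝ³ = ℂ × ℝ`, where `ℂ` is the horizontal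
`x,y`-plane and the second factor is the vertical coordinate. -/
abbrev S3 : Type := OnePoint (ℂ × ℝ)

/-- A chord diagram on the unit disk of `ℂ`: straight oriented chords, labelled by `ι`, whose
`2 |ι|` endpoints are pairwise distinct points of the unit circle.
The chord `i` runs from `endpt (i, false)` to `endpt (i, true)`. -/
structure ChordDiagram (ι : Type*) where
  endpt : ι × Bool → Circle
  endpt_injective : Function.Injective endpt

namespace ChordDiagram

variable {ι : Type*}

/-- The chord `i`, as a segment in the disk. -/
def chord (L : ChordDiagram ι) (i : ι) : Set ℂ :=
  segment ℝ (L.endpt (i, false) : ℂ) (L.endpt (i, true) : ℂ)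

/-- The incidence graph: the vertices are the chords, and distinct chords are joined by an edge
when they meet. -/
def incidenceGraph (L : ChordDiagram ι) : SimpleGraph ι where
  Adj i j := i ≠ j ∧ (L.chord i ∩ L.chord j).Nonempty
  symm := ⟨fun _ _ h => ⟨h.1.symm, Set.inter_comm _ _ ▸ h.2⟩⟩
  loopless := ⟨fun _ h => h.1 rfl⟩

/-- The directed incidence graph of an ordering `σ` of the chords: every edge of the incidence
graph is directed so that it points to the vertex of larger index. -/
def directedIncidenceGraph (L : ChordDiagram ι) {n : ℕ} (σ : ι ≃ Fin n) : Digraph ι where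
  Adj i j := L.incidenceGraph.Adj i j ∧ σ i < σ j

/-- `ε` is an admissible half-width for bands: the closed arcs of angular half-width `ε` about the
endpoints of the chords are pairwise disjoint. Bands are attached to the disk along these arcs. -/
def IsBandWidth (L : ChordDiagram ι) (ε : ℝ) : Prop :=
  0 < ε ∧ Pairwise fun a b : ι × Bool =>
    ∀ u ∈ Set.Icc (-ε) ε, ∀ w ∈ Set.Icc (-ε) ε,
      Circle.exp u * L.endpt a ≠ Circle.exp w * L.endpt b

/-- Every chord diagram with finitely many chords has an admissible half-width. -/
theorem exists_isBandWidth [Finite ι] (L : ChordDiagram ι) : ∃ ε, L.IsBandWidth ε := by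
  have key : ∀ a b : ι × Bool, ∃ δ : ℝ, 0 < δ ∧ (a ≠ b →
      ∀ u ∈ Set.Icc (-δ) δ, ∀ w ∈ Set.Icc (-δ) δ,
        Circle.exp u * L.endpt a ≠ Circle.exp w * L.endpt b) := by
    intro a b
    by_cases hab : a = b
    · exact ⟨1, one_pos, fun h => absurd hab h⟩
    have ho : IsOpen {p : ℝ × ℝ | Circle.exp p.1 * L.endpt a ≠ Circle.exp p.2 * L.endpt b} :=
      isOpen_ne_fun (by fun_prop) (by fun_prop)
    have h0 : ((0 : ℝ), (0 : ℝ)) ∈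
        {p : ℝ × ℝ | Circle.exp p.1 * L.endpt a ≠ Circle.exp p.2 * L.endpt b} := by
      simpa using fun h => hab (L.endpt_injective h)
    obtain ⟨r, hr, hball⟩ := Metric.isOpen_iff.1 ho _ h0
    refine ⟨r / 2, by positivity, fun _ u hu w hw => ?_⟩
    suffices hm : (u, w) ∈ Metric.ball ((0 : ℝ), (0 : ℝ)) r from hball hm
    have h1 := abs_le.2 hu
    have h2 := abs_le.2 hw
    rw [Metric.mem_ball, Prod.dist_eq, max_lt_iff]
    simp only [Real.dist_eq, sub_zero]
    constructor <;> linarith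
  choose δ hδ hne using key
  obtain ⟨ε, hε, hle⟩ : ∃ ε : ℝ, 0 < ε ∧ ∀ p : (ι × Bool) × (ι × Bool), ε ≤ δ p.1 p.2 := by
    rcases isEmpty_or_nonempty ((ι × Bool) × (ι × Bool)) with h | h
    · exact ⟨1, one_pos, fun p => h.elim p⟩
    · obtain ⟨q, hq⟩ := Finite.exists_min fun p : (ι × Bool) × (ι × Bool) => δ p.1 p.2
      exact ⟨δ q.1 q.2, hδ _ _, hq⟩
  refine ⟨ε, hε, fun a b hab u hu w hw => ?_⟩
  have h := hle (a, b)
  simp only at h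
  exact hne a b hab u ⟨by linarith [hu.1], by linarith [hu.2]⟩ w
    ⟨by linarith [hw.1], by linarith [hw.2]⟩

/-- The point at parameter `s ∈ [0, 1]` on the chord which is parallel to the chord `i` and is
obtained by turning the two endpoints of `i` through the angles `-w` and `w`. For `|w| ≤ ε` these
points fill the strip about the chord `i` between two parallel chords. -/
def stripPoint (L : ChordDiagram ι) (i : ι) (s w : ℝ) : ℂ :=
  ((1 - s : ℝ) : ℂ) * ((Circle.exp (-w) * L.endpt (i, false) : Circle) : ℂ) +
    (s : ℂ) * ((Circle.exp w * L.endpt (i, true) : Circle) : ℂ)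

/-- Parametrization of the twisted band at level `h` along the chord `i`; here `s ∈ [0, 1]` is the
position along the band and `v ∈ [-1, 1]` the position across it.
The projection of the band to the plane stays in the strip of half-width `ε` about the chord. Over
the point `x` of the disk, the layer of level `h` lies at the height `(1 - |x|²) h`, so that it
leaves the plane along the unit circle, and layers of larger level lie above those of smaller
level. While `s` runs from `0` to `1` the cross-section of the band makes exactly one full turn
about the core `v = 0`, and it stays between the levels `h - 1/4` and `h + 1/4`. The turn is
right-handed for `χ = 1` and left-handed for `χ = -1`. -/
def bandPoint (L : ChordDiagram ι) (ε : ℝ) (χ : ℤˣ) (h : ℝ) (i : ι) (s v : ℝ) : ℂ × ℝ :=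
  let x : ℂ := L.stripPoint i s (ε * (v * Real.cos (2 * Real.pi * s)))
  (x, (1 - ‖x‖ ^ 2) * (h + ((χ : ℤ) : ℝ) * (v * Real.sin (2 * Real.pi * s)) / 4))

/-- The band `η_i`, as a subset of `ℝ³`. -/
def band (L : ChordDiagram ι) (ε : ℝ) (χ : ℤˣ) (h : ℝ) (i : ι) : Set (ℂ × ℝ) :=
  {p | ∃ s ∈ Set.Icc (0 : ℝ) 1, ∃ v ∈ Set.Icc (-1 : ℝ) 1, L.bandPoint ε χ h i s v = p}

end ChordDiagram

/-- The unit disk `D` in the horizontal plane of `ℝ³`. -/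
def flatDisk : Set (ℂ × ℝ) := Metric.closedBall (0 : ℂ) 1 ×ˢ {(0 : ℝ)}

/-- The unit disk `D`, as a subset of `S³`. -/
def flatDiskS3 : Set S3 := ((↑) : ℂ × ℝ → S3) '' flatDisk

/-- The boundary of a surface `S` in a space `X`, in the sense of topological manifolds with
boundary: the points of `S` that have no open neighbourhood in `S` homeomorphic to an open subset
of the plane. -/
def surfaceBoundary {X : Type*} [TopologicalSpace X] (S : Set X) : Set X :=
  {x | ∃ hx : x ∈ S, ∀ e : OpenPartialHomeomorph S (EuclideanSpace ℝ (Fin 2)),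
    (⟨x, hx⟩ : S) ∉ e.source}

namespace ChordDiagram

variable {ι : Type*}

/-- The surface `Σ` in `S³` of a chord diagram with the ordering `σ`: the disk `D` together with
one twisted band for each chord, attached over `D` in the given order, so that the band of the
chord of larger index lies over the band of the chord of smaller index. -/
def fiberSurface (L : ChordDiagram ι) {n : ℕ} (σ : ι ≃ Fin n) (ε : ℝ) (χ : ℤˣ) : Set S3 :=
  ((↑) : ℂ × ℝ → S3) '' (flatDisk ∪ ⋃ i, L.band ε χ ((σ i : ℕ) + 1) i)

/-- The link `K = ∂Σ` in `S³` of a chord diagram with the ordering `σ`. -/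
def fiberedLink (L : ChordDiagram ι) {n : ℕ} (σ : ι ≃ Fin n) (ε : ℝ) (χ : ℤˣ) : Set S3 :=
  surfaceBoundary (L.fiberSurface σ ε χ)

end ChordDiagram

/-- An ambient isotopy of a space `X`: a continuous family of self-homeomorphisms of `X`, starting
at the identity. -/
structure AmbientIsotopy (X : Type*) [TopologicalSpace X] where
  toHomeo : unitInterval → X ≃ₜ X
  continuous_toHomeo : Continuous fun p : unitInterval × X => toHomeo p.1 p.2
  toHomeo_zero : toHomeo 0 = Homeomorph.refl X

end

/-! The isotopy is vertical: it keeps `x` and moves only the level `s` in the height `(1 - |x|²) s`.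
Over `x` only the bands whose strips contain `x` matter. If two strips overlap, their chords meet
(`chord_inter_nonempty_of_mem_strip`), so equal directed graphs force `σ` and `τ` to order the bands
over `x` alike. Hence an increasing map of the level line, fixed outside `(0, n + 1)`, carries every
slab of radius 1/4 over `x` from its `σ`-level to its `τ`-level (`exists_levelMap_of_orderings`).

These conditions on the map are convex, and since strips are closed, a map chosen at `x` also works
near `x`; a partition of unity yields a continuous family (`exists_continuous_levelMap`).
Interpolating linearly from the identity and rescaling by `1 - |x|²` gives a compactly supported
isotopy of `ℝ³`, hence one of `S³` (`exists_ambientIsotopy_of_levelMaps`). Level 0 is fixed, so `D`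
is too; the links follow because the boundary is a topological invariant. -/

/-! ### Plane geometry of chords of the unit circle -/

/-- Twice the signed area of the triangle `p q z`; its sign tells on which side of the line `p q`
the point `z` lies. -/
def lineSide (p q z : ℂ) : ℝ :=
  (q.re - p.re) * (z.im - p.im) - (q.im - p.im) * (z.re - p.re)

theorem lineSide_lineMap (p q r s : ℂ) (t : ℝ) :
    lineSide p q ((1 - t : ℝ) * r + (t : ℝ) * s) =
      (1 - t) * lineSide p q r + t * lineSide p q s := by
  simp only [lineSide, Complex.add_re, Complex.add_im, Complex.re_ofReal_mul,
    Complex.im_ofReal_mul]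
  ring

theorem exists_lineMap_of_lineSide_eq_zero {p q z : ℂ} (hpq : p ≠ q)
    (h : lineSide p q z = 0) : ∃ t : ℝ, z = (1 - t : ℝ) * p + (t : ℝ) * q := by
  have hd : 0 < (q.re - p.re) ^ 2 + (q.im - p.im) ^ 2 := by
    by_contra hcon
    refine hpq (Complex.ext ?_ ?_) <;> nlinarith [sq_nonneg (q.re - p.re), sq_nonneg (q.im - p.im)]
  -- The parameter of the orthogonal projection of `z` to the line `p q`.
  refine ⟨((q.re - p.re) * (z.re - p.re) + (q.im - p.im) * (z.im - p.im)) /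
    ((q.re - p.re) ^ 2 + (q.im - p.im) ^ 2), ?_⟩
  unfold lineSide at h
  apply Complex.ext
  · simp only [Complex.add_re, Complex.re_ofReal_mul]
    field_simp
    linear_combination (-(q.im - p.im)) * h
  · simp only [Complex.add_im, Complex.im_ofReal_mul]
    field_simp
    linear_combination (q.re - p.re) * h

/-- Power of a point: the sign of `t * (t - 1)` tells whether a point of the line `p q` is inside,
on or outside the circle. -/
theorem norm_sq_lineMap {p q : ℂ} (hp : ‖p‖ = 1) (hq : ‖q‖ = 1) (t : ℝ) :
    ‖((1 - t : ℝ) * p + (t : ℝ) * q : ℂ)‖ ^ 2 = 1 + t * (t - 1) * ‖q - p‖ ^ 2 := by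
  have h1 : p.re * p.re + p.im * p.im = 1 := by
    rw [← Complex.normSq_apply, ← Complex.sq_norm, hp, one_pow]
  have h2 : q.re * q.re + q.im * q.im = 1 := by
    rw [← Complex.normSq_apply, ← Complex.sq_norm, hq, one_pow]
  simp only [Complex.sq_norm, Complex.normSq_apply, Complex.add_re, Complex.add_im,
    Complex.re_ofReal_mul, Complex.im_ofReal_mul, Complex.sub_re, Complex.sub_im]
  linear_combination (1 - t) * h1 + t * h2

theorem mem_segment_of_lineSide_eq_zero {p q z : ℂ} (hp : ‖p‖ = 1) (hq : ‖q‖ = 1) (hpq : p ≠ q)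
    (hz : ‖z‖ ≤ 1) (h : lineSide p q z = 0) : z ∈ segment ℝ p q := by
  obtain ⟨t, rfl⟩ := exists_lineMap_of_lineSide_eq_zero hpq h
  have hn := norm_sq_lineMap hp hq t
  have hd : 0 < ‖q - p‖ ^ 2 := pow_pos (norm_pos_iff.2 (sub_ne_zero.2 hpq.symm)) 2
  have h1 : ‖((1 - t : ℝ) * p + (t : ℝ) * q : ℂ)‖ ^ 2 ≤ 1 := pow_le_one₀ (norm_nonneg _) hz
  have h2 : t * (t - 1) ≤ 0 := by
    by_contra hcon
    nlinarith [mul_pos (not_le.1 hcon) hd]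
  refine ⟨1 - t, t, by nlinarith, by nlinarith, by ring, by simp⟩

theorem lineSide_ne_zero {p q z : ℂ} (hp : ‖p‖ = 1) (hq : ‖q‖ = 1) (hz : ‖z‖ = 1) (hpq : p ≠ q)
    (hzp : z ≠ p) (hzq : z ≠ q) : lineSide p q z ≠ 0 := by
  intro h
  obtain ⟨t, rfl⟩ := exists_lineMap_of_lineSide_eq_zero hpq h
  have hn := norm_sq_lineMap hp hq t
  have hd : ‖q - p‖ ^ 2 ≠ 0 := pow_ne_zero 2 (norm_ne_zero_iff.2 (sub_ne_zero.2 hpq.symm))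
  rw [hz] at hn
  have h2 : t * (t - 1) = 0 := by
    have : t * (t - 1) * ‖q - p‖ ^ 2 = 0 := by linarith
    exact (mul_eq_zero.1 this).resolve_right hd
  rcases mul_eq_zero.1 h2 with h0 | h0
  · exact hzp (by simp [h0])
  · exact hzq (by simp [sub_eq_zero.1 h0])

theorem segment_inter_nonempty_of_lineSide {p q r s : ℂ} (hp : ‖p‖ = 1) (hq : ‖q‖ = 1)
    (hr : ‖r‖ = 1) (hs : ‖s‖ = 1) (hpq : p ≠ q)
    (h : lineSide p q r * lineSide p q s ≤ 0) : (segment ℝ p q ∩ segment ℝ r s).Nonempty := by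
  obtain ⟨t, ht, h0⟩ : ∃ t ∈ Set.Icc (0 : ℝ) 1,
      (1 - t) * lineSide p q r + t * lineSide p q s = 0 := by
    have hc : ContinuousOn (fun t : ℝ => (1 - t) * lineSide p q r + t * lineSide p q s)
        (Set.uIcc 0 1) := by fun_prop
    have hi := intermediate_value_uIcc hc
    have : (0 : ℝ) ∈ (fun t : ℝ => (1 - t) * lineSide p q r + t * lineSide p q s) ''
        Set.uIcc 0 1 := by
      apply hi
      rw [Set.mem_uIcc]
      rcases mul_nonpos_iff.1 h with h | h
      · right; simpa using h.symm
      · left; simpa using h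
    simpa [Set.uIcc_of_le] using this
  have hm : ((1 - t : ℝ) * r + (t : ℝ) * s : ℂ) ∈ segment ℝ r s :=
    ⟨1 - t, t, by linarith [ht.2], ht.1, by ring, by simp⟩
  refine ⟨_, mem_segment_of_lineSide_eq_zero hp hq hpq ?_ ?_, hm⟩
  -- Lying in the disk puts the zero on the chord `p q`, not merely on its line.
  · have hsub := (convex_closedBall (0 : ℂ) 1).segment_subset (x := r) (y := s)
      (by simp [hr]) (by simp [hs]) hm
    simpa using hsub
  · rw [lineSide_lineMap, h0]

/-! ### Overlapping strips have crossing chords -/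

namespace ChordDiagram

variable {ι : Type*}

/-- The closed strip of half-width `ε` about the chord `i`. -/
def strip (L : ChordDiagram ι) (ε : ℝ) (i : ι) : Set ℂ :=
  (fun p : ℝ × ℝ => L.stripPoint i p.1 p.2) '' (Set.Icc 0 1 ×ˢ Set.Icc (-ε) ε)

theorem isClosed_strip (L : ChordDiagram ι) (ε : ℝ) (i : ι) : IsClosed (L.strip ε i) := by
  refine ((isCompact_Icc.prod isCompact_Icc).image ?_).isClosed
  unfold stripPoint
  fun_prop

theorem norm_stripPoint_le (L : ChordDiagram ι) (i : ι) {s : ℝ} (hs : s ∈ Set.Icc (0 : ℝ) 1)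
    (w : ℝ) : ‖L.stripPoint i s w‖ ≤ 1 := by
  unfold stripPoint
  refine (norm_add_le _ _).trans ?_
  rw [norm_mul, norm_mul, Circle.norm_coe, Circle.norm_coe, Complex.norm_real, Complex.norm_real,
    Real.norm_of_nonneg hs.1, Real.norm_of_nonneg (sub_nonneg.2 hs.2)]
  linarith

/-- Take the parallel chords through `x` in both strips and turn them back to the original chords by
scaling the angles by `t` from 1 to 0. The four endpoints stay distinct, so neither endpoint of one
chord ever reaches the line of the other, and the crossing persists. -/
theorem chord_inter_nonempty_of_mem_strip {L : ChordDiagram ι} {ε : ℝ} (hε : L.IsBandWidth ε)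
    {i j : ι} (hij : i ≠ j) {x : ℂ} (hi : x ∈ L.strip ε i) (hj : x ∈ L.strip ε j) :
    (L.chord i ∩ L.chord j).Nonempty := by
  obtain ⟨⟨a, w⟩, ⟨ha, hw⟩, hx⟩ := hi
  obtain ⟨⟨b, v⟩, ⟨hb, hv⟩, hx'⟩ := hj
  simp only at ha hw hx hb hv hx'
  have hne : ∀ a b : ι × Bool, a ≠ b → ∀ u ∈ Set.Icc (-ε) ε, ∀ w ∈ Set.Icc (-ε) ε,
      ((Circle.exp u * L.endpt a : Circle) : ℂ) ≠ ((Circle.exp w * L.endpt b : Circle) : ℂ) :=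
    fun a b hab u hu w hw h => hε.2 hab u hu w hw (Circle.ext h)
  have hsc : ∀ u ∈ Set.Icc (-ε) ε, ∀ t ∈ Set.Icc (0 : ℝ) 1, t * u ∈ Set.Icc (-ε) ε := by
    intro u hu t ht
    have h1 := abs_le.2 hu
    refine abs_le.1 ?_
    rw [abs_mul, abs_of_nonneg ht.1]
    exact (mul_le_of_le_one_left (abs_nonneg u) ht.2).trans h1
  have hneg : ∀ u ∈ Set.Icc (-ε) ε, -u ∈ Set.Icc (-ε) ε :=
    fun u hu => ⟨by linarith [hu.2], by linarith [hu.1]⟩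
  set P : ℝ → ℂ := fun t => ((Circle.exp (-(t * w)) * L.endpt (i, false) : Circle) : ℂ) with hP
  set Q : ℝ → ℂ := fun t => ((Circle.exp (t * w) * L.endpt (i, true) : Circle) : ℂ) with hQ
  set R : ℝ → ℂ := fun t => ((Circle.exp (-(t * v)) * L.endpt (j, false) : Circle) : ℂ) with hR
  set S : ℝ → ℂ := fun t => ((Circle.exp (t * v) * L.endpt (j, true) : Circle) : ℂ) with hS
  have hPQ : ∀ t ∈ Set.Icc (0 : ℝ) 1, P t ≠ Q t := fun t ht =>
    hne _ _ (by simp) _ (hneg _ (hsc w hw t ht)) _ (hsc w hw t ht)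
  have hside : ∀ t ∈ Set.Icc (0 : ℝ) 1,
      lineSide (P t) (Q t) (R t) * lineSide (P t) (Q t) (S t) ≠ 0 := by
    intro t ht
    have h1 := hsc w hw t ht
    have h2 := hsc v hv t ht
    refine mul_ne_zero
      (lineSide_ne_zero (Circle.norm_coe _) (Circle.norm_coe _) (Circle.norm_coe _) (hPQ t ht)
        (hne _ _ ?_ _ (hneg _ h2) _ (hneg _ h1)) (hne _ _ ?_ _ (hneg _ h2) _ h1))
      (lineSide_ne_zero (Circle.norm_coe _) (Circle.norm_coe _) (Circle.norm_coe _) (hPQ t ht)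
        (hne _ _ ?_ _ h2 _ (hneg _ h1)) (hne _ _ ?_ _ h2 _ h1)) <;> simp [hij.symm]
  have hcont : ContinuousOn
      (fun t => lineSide (P t) (Q t) (R t) * lineSide (P t) (Q t) (S t)) (Set.Icc 0 1) := by
    refine Continuous.continuousOn ?_
    simp only [lineSide, hP, hQ, hR, hS]
    fun_prop
  have h1 : lineSide (P 1) (Q 1) (R 1) * lineSide (P 1) (Q 1) (S 1) ≤ 0 := by
    have e1 : x = (1 - a : ℝ) * P 1 + (a : ℝ) * Q 1 := by
      rw [← hx]; simp only [hP, hQ, one_mul, stripPoint]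
    have e2 : x = (1 - b : ℝ) * R 1 + (b : ℝ) * S 1 := by
      rw [← hx']; simp only [hR, hS, one_mul, stripPoint]
    -- `lineSide` is affine along the second chord and vanishes at `x`, so its end values cannot
    -- have the same strict sign.
    have h0 := lineSide_lineMap (P 1) (Q 1) (R 1) (S 1) b
    rw [← e2, e1, lineSide_lineMap] at h0
    have hz1 : lineSide (P 1) (Q 1) (P 1) = 0 := by simp [lineSide]
    have hz2 : lineSide (P 1) (Q 1) (Q 1) = 0 := by unfold lineSide; ring
    rw [hz1, hz2] at h0
    by_contra hcon
    rcases mul_pos_iff.1 (not_le.1 hcon) with ⟨u1, u2⟩ | ⟨u1, u2⟩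
    · rcases hb.1.eq_or_lt with rfl | hb0
      · linarith
      · nlinarith [mul_pos hb0 u2, mul_nonneg (sub_nonneg.2 hb.2) u1.le]
    · rcases hb.1.eq_or_lt with rfl | hb0
      · linarith
      · nlinarith [mul_pos hb0 (neg_pos.2 u2), mul_nonneg (sub_nonneg.2 hb.2) (neg_pos.2 u1).le]
  have h0 : lineSide (P 0) (Q 0) (R 0) * lineSide (P 0) (Q 0) (S 0) ≤ 0 := by
    by_contra hcon
    obtain ⟨t, ht, hz⟩ := intermediate_value_Icc' zero_le_one hcont
      (show (0 : ℝ) ∈ _ from ⟨h1, (not_le.1 hcon).le⟩)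
    exact hside t ht hz
  have := segment_inter_nonempty_of_lineSide (Circle.norm_coe _) (Circle.norm_coe _)
    (Circle.norm_coe _) (Circle.norm_coe _) (hPQ 0 (by simp)) h0
  simpa [hP, hQ, hR, hS, chord] using this

end ChordDiagram

/-! ### Compactly supported isotopies and the one-point compactification -/

section

open Filter Topology OnePoint

/-- The boundary of a surface is carried along by homeomorphisms of the ambient space. -/
theorem image_surfaceBoundary {X Y : Type*} [TopologicalSpace X] [TopologicalSpace Y] (h : X ≃ₜ Y)
    (S : Set X) : h '' surfaceBoundary S = surfaceBoundary (h '' S) := by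
  ext y
  constructor
  · rintro ⟨x, ⟨hx, H⟩, rfl⟩
    exact ⟨Set.mem_image_of_mem h hx,
      fun e he => H ((h.image S).toOpenPartialHomeomorph.trans e) ⟨trivial, he⟩⟩
  · rintro ⟨⟨x, hx, rfl⟩, H⟩
    refine ⟨x, ⟨hx, fun e he => ?_⟩, rfl⟩
    refine H ((h.image S).symm.toOpenPartialHomeomorph.trans e) ⟨trivial, ?_⟩
    have : (h.image S).symm ⟨h x, Set.mem_image_of_mem h hx⟩ = ⟨x, hx⟩ :=
      (h.image S).symm_apply_eq.2 rfl
    simpa [this] using he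

/-- A continuous family of self-maps with compact support extends continuously to the one-point
compactification. -/
theorem OnePoint.continuous_map_of_eq_off_compact {T X : Type*} [TopologicalSpace T]
    [TopologicalSpace X] (G : T → X → X)
    (hG : Continuous fun p : T × X => G p.1 p.2) {K : Set X} (hK : IsCompact K)
    (hKc : IsClosed K) (hGK : ∀ t, ∀ x ∉ K, G t x = x) :
    Continuous fun p : T × OnePoint X => OnePoint.map (G p.1) p.2 := by
  rw [continuous_iff_continuousAt]
  rintro ⟨t, x⟩
  induction x using OnePoint.rec with
  | infty =>
    have hU : ((↑) '' K : Set (OnePoint X))ᶜ ∈ 𝓝 (∞ : OnePoint X) :=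
      (OnePoint.isOpen_compl_image_coe.2 ⟨hKc, hK⟩).mem_nhds (by simp)
    have hev : (fun p : T × OnePoint X => OnePoint.map (G p.1) p.2) =ᶠ[𝓝 (t, ∞)]
        fun p => p.2 := by
      filter_upwards [(continuous_snd.tendsto (t, (∞ : OnePoint X))) hU] with p hp
      obtain ⟨u, y⟩ := p
      induction y using OnePoint.rec with
      | infty => rfl
      | coe y =>
        have hy : y ∉ K := fun h => hp (Set.mem_image_of_mem _ h)
        simp [OnePoint.map_some, hGK u y hy]
    exact (continuous_snd.continuousAt).congr hev.symm
  | coe x =>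
    have he : IsOpenEmbedding (Prod.map id (↑) : T × X → T × OnePoint X) :=
      IsOpenEmbedding.id.prodMap OnePoint.isOpenEmbedding_coe
    refine (he.continuousAt_iff (x := (t, x))).1 ?_
    exact (OnePoint.continuous_coe.comp hG).continuousAt

/-- A compactly supported isotopy extends to an ambient isotopy of the one-point
compactification. -/
theorem exists_ambientIsotopy_onePoint {X : Type*} [TopologicalSpace X] [T2Space X]
    [WeaklyLocallyCompactSpace X] (G : unitInterval → X → X)
    (hG : Continuous fun p : unitInterval × X => G p.1 p.2) (hbij : ∀ t, (G t).Bijective)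
    (h0 : ∀ x, G 0 x = x) {K : Set X} (hK : IsCompact K) (hGK : ∀ t, ∀ x ∉ K, G t x = x) :
    ∃ H : AmbientIsotopy (OnePoint X), ∀ t (x : X), H.toHomeo t x = (G t x : X) := by
  have hc := OnePoint.continuous_map_of_eq_off_compact G hG hK hK.isClosed hGK
  have hb : ∀ t, (OnePoint.map (G t)).Bijective := fun t =>
    ⟨Option.map_injective (hbij t).1, fun y => by
      induction y using OnePoint.rec with
      | infty => exact ⟨∞, rfl⟩
      | coe y =>
        obtain ⟨x, rfl⟩ := (hbij t).2 y
        exact ⟨x, rfl⟩⟩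
  -- Continuity of the inverses is free: the source is compact and the target Hausdorff.
  refine ⟨⟨fun t => Continuous.homeoOfEquivCompactToT2 (f := Equiv.ofBijective _ (hb t))
    (hc.comp (Continuous.prodMk_right t)), hc, ?_⟩, fun t x => rfl⟩
  ext x
  induction x using OnePoint.rec with
  | infty => rfl
  | coe x => exact congrArg _ (h0 x)

/-! ### Monotone functions: extension and joint continuity -/

/-- A partial function of a real variable whose difference quotients lie between `C⁻¹` and `C`
extends to a strictly increasing continuous function. -/
theorem exists_strictMono_continuous_of_graph (Γ : Set (ℝ × ℝ)) {C : ℝ} (hC : 1 ≤ C)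
    (hΓ : ∀ p ∈ Γ, ∀ q ∈ Γ, p.1 ≤ q.1 →
      q.1 - p.1 ≤ C * (q.2 - p.2) ∧ q.2 - p.2 ≤ C * (q.1 - p.1)) :
    ∃ φ : ℝ → ℝ, StrictMono φ ∧ Continuous φ ∧ ∀ p ∈ Γ, φ p.1 = p.2 := by
  have hC0 : 0 < C := by linarith
  have hfun : ∀ p ∈ Γ, ∀ q ∈ Γ, p.1 = q.1 → p.2 = q.2 := by
    intro p hp q hq h
    have h1 := (hΓ p hp q hq h.le).2
    have h2 := (hΓ q hq p hp h.ge).2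
    rw [h, sub_self, mul_zero] at h1
    rw [h, sub_self, mul_zero] at h2
    linarith
  have hf : ∀ x, ∃ y, ∀ p ∈ Γ, p.1 = x → p.2 = y := by
    intro x
    by_cases hx : ∃ p ∈ Γ, p.1 = x
    · obtain ⟨q, hq, rfl⟩ := hx
      exact ⟨q.2, fun p hp h => hfun p hp q hq h⟩
    · exact ⟨0, fun p hp h => (hx ⟨p, hp, h⟩).elim⟩
  choose f hf using hf
  have hC1 : C⁻¹ ≤ C := (inv_le_one_of_one_le₀ hC).trans hC
  -- Subtracting the mean slope turns the two-sided slope bound into a Lipschitz bound. Lipschitz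
  -- extension preserves it, and adding the mean slope back leaves slopes at least `C⁻¹ > 0`.
  have hlip : LipschitzOnWith (Real.toNNReal ((C - C⁻¹) / 2))
      (fun x => f x - (C + C⁻¹) / 2 * x) (Prod.fst '' Γ) := by
    have key : ∀ p ∈ Γ, ∀ q ∈ Γ, p.1 ≤ q.1 →
        |(q.2 - (C + C⁻¹) / 2 * q.1) - (p.2 - (C + C⁻¹) / 2 * p.1)| ≤
          (C - C⁻¹) / 2 * |q.1 - p.1| := by
      intro p hp q hq h
      obtain ⟨h1, h2⟩ := hΓ p hp q hq h
      have h3 : C⁻¹ * (q.1 - p.1) ≤ q.2 - p.2 := by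
        rw [inv_mul_le_iff₀ hC0]; exact h1
      rw [abs_of_nonneg (sub_nonneg.2 h), abs_le]
      constructor <;> linarith
    refine LipschitzOnWith.of_dist_le_mul ?_
    rintro _ ⟨p, hp, rfl⟩ _ ⟨q, hq, rfl⟩
    rw [Real.coe_toNNReal _ (by linarith), Real.dist_eq, Real.dist_eq, ← hf p.1 p hp rfl,
      ← hf q.1 q hq rfl]
    rcases le_total p.1 q.1 with h | h
    · rw [abs_sub_comm, abs_sub_comm p.1]; exact key p hp q hq h
    · exact key q hq p hp h
  obtain ⟨g, hg, hgf⟩ := hlip.extend_real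
  refine ⟨fun x => g x + (C + C⁻¹) / 2 * x, ?_, ?_, ?_⟩
  · intro x y hxy
    have h1 := hg.dist_le_mul x y
    rw [Real.coe_toNNReal _ (by linarith), Real.dist_eq, Real.dist_eq, abs_sub_comm x y,
      abs_of_pos (sub_pos.2 hxy)] at h1
    have h2 := (abs_le.1 h1).2
    have h3 : 0 < C⁻¹ * (y - x) := mul_pos (inv_pos.2 hC0) (sub_pos.2 hxy)
    change g x + _ < g y + _
    linarith
  · exact hg.continuous.add (by fun_prop)
  · intro p hp
    have h1 := hgf (Set.mem_image_of_mem _ hp)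
    simp only at h1 ⊢
    rw [← h1, hf p.1 p hp rfl]
    ring

/-- A pointwise continuous family of monotone continuous functions is jointly continuous. -/
theorem continuous_uncurry_of_monotone {X : Type*} [TopologicalSpace X] {g : X → ℝ → ℝ}
    (hmono : ∀ x, Monotone (g x)) (hcont : ∀ x, Continuous (g x))
    (hpt : ∀ s, Continuous fun x => g x s) : Continuous fun p : X × ℝ => g p.1 p.2 := by
  rw [continuous_iff_continuousAt]
  rintro ⟨x, s⟩
  refine tendsto_order.2 ⟨fun a ha => ?_, fun a ha => ?_⟩
  · have h1 : ∀ᶠ u in 𝓝 s, a < g x u := (hcont x).continuousAt.eventually (lt_mem_nhds ha)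
    -- Pointwise continuity at one fixed `u < s` suffices: monotonicity passes the bound to all `v >
    -- u`.
    obtain ⟨u, hu, hus⟩ := ((h1.filter_mono nhdsWithin_le_nhds).and
      (self_mem_nhdsWithin : Set.Iio s ∈ 𝓝[<] s)).exists
    have h2 : ∀ᶠ y in 𝓝 x, a < g y u := (hpt u).continuousAt.eventually (lt_mem_nhds hu)
    have h3 : ∀ᶠ v in 𝓝 s, u < v := lt_mem_nhds hus
    rw [nhds_prod_eq]
    filter_upwards [h2.prod_mk h3] with p hp
    exact hp.1.trans_le (hmono _ hp.2.le)
  · have h1 : ∀ᶠ u in 𝓝 s, g x u < a := (hcont x).continuousAt.eventually (gt_mem_nhds ha)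
    obtain ⟨u, hu, hus⟩ := ((h1.filter_mono nhdsWithin_le_nhds).and
      (self_mem_nhdsWithin : Set.Ioi s ∈ 𝓝[>] s)).exists
    have h2 : ∀ᶠ y in 𝓝 x, g y u < a := (hpt u).continuousAt.eventually (gt_mem_nhds hu)
    have h3 : ∀ᶠ v in 𝓝 s, v < u := gt_mem_nhds hus
    rw [nhds_prod_eq]
    filter_upwards [h2.prod_mk h3] with p hp
    exact (hmono _ hp.2.le).trans_lt hp.1

/-! ### Level maps and their rescaling -/

/-- The strictly increasing continuous functions which are the identity outside `(0, N)`. -/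
def levelMaps (N : ℝ) : Set (ℝ → ℝ) :=
  {φ | StrictMono φ ∧ Continuous φ ∧ ∀ s, s ≤ 0 ∨ N ≤ s → φ s = s}

theorem id_mem_levelMaps (N : ℝ) : id ∈ levelMaps N :=
  ⟨strictMono_id, continuous_id, fun _ _ => rfl⟩

theorem convex_levelMaps (N : ℝ) : Convex ℝ (levelMaps N) := by
  rintro φ ⟨h1, h2, h3⟩ ψ ⟨k1, k2, k3⟩ a b ha hb hab
  refine ⟨fun x y hxy => ?_, (h2.const_smul a).add (k2.const_smul b), fun s hs => ?_⟩
  · have u1 := mul_le_mul_of_nonneg_left (h1 hxy).le ha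
    have u2 := mul_le_mul_of_nonneg_left (k1 hxy).le hb
    simp only [Pi.add_apply, Pi.smul_apply, smul_eq_mul]
    rcases ha.eq_or_lt with rfl | ha
    · have := mul_lt_mul_of_pos_left (k1 hxy) (show 0 < b by linarith)
      linarith
    · have := mul_lt_mul_of_pos_left (h1 hxy) ha
      linarith
  · simp only [Pi.add_apply, Pi.smul_apply, smul_eq_mul, h3 s hs, k3 s hs]
    rw [← add_mul, hab, one_mul]

theorem abs_sub_le_of_mem_levelMaps {N : ℝ} (hN : 0 ≤ N) {φ : ℝ → ℝ} (h : φ ∈ levelMaps N)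
    (s : ℝ) : |φ s - s| ≤ N := by
  obtain ⟨h1, -, h3⟩ := h
  by_cases hs : s ≤ 0 ∨ N ≤ s
  · simpa [h3 s hs] using hN
  · push Not at hs
    have u1 := h1.monotone hs.1.le
    have u2 := h1.monotone hs.2.le
    rw [h3 0 (.inl le_rfl)] at u1
    rw [h3 N (.inr le_rfl)] at u2
    rw [abs_le]
    constructor <;> linarith [hs.1, hs.2]

/-- Scaling a function by a factor `r ≥ 0` in domain and codomain, as a self-map of the line
(the identity for `r = 0`). -/
noncomputable def rescale (φ : ℝ → ℝ) (r z : ℝ) : ℝ := z + r * (φ (z / r) - z / r)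

theorem rescale_mul (φ : ℝ → ℝ) (r s : ℝ) : rescale φ r (r * s) = r * φ s := by
  rcases eq_or_ne r 0 with rfl | hr
  · simp [rescale]
  · rw [rescale, mul_div_cancel_left₀ _ hr]
    ring

/-- For `r > 0` this is conjugation by scaling, which shrinks the support to `[0, r * N]`, inside
`[0, N]` as `r ≤ 1`. -/
theorem rescale_mem_levelMaps {N r : ℝ} (hN : 0 ≤ N) (hr : 0 ≤ r) (hr1 : r ≤ 1) {φ : ℝ → ℝ}
    (h : φ ∈ levelMaps N) : rescale φ r ∈ levelMaps N := by
  rcases hr.eq_or_lt with rfl | hr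
  · have he : rescale φ 0 = id := by ext z; simp [rescale]
    exact he ▸ id_mem_levelMaps N
  have he : rescale φ r = fun z => r * φ (z / r) := by
    ext z
    rw [← rescale_mul, mul_div_cancel₀ _ hr.ne']
  obtain ⟨h1, h2, h3⟩ := h
  rw [he]
  refine ⟨fun x y hxy => ?_, by fun_prop, fun s hs => ?_⟩
  · exact mul_lt_mul_of_pos_left (h1 (div_lt_div_of_pos_right hxy hr)) hr
  · change r * φ (s / r) = s
    rw [h3, mul_div_cancel₀ _ hr.ne']
    refine hs.imp (fun hs => div_nonpos_of_nonpos_of_nonneg hs hr.le) fun hs => ?_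
    rw [le_div_iff₀ hr]
    exact (mul_le_of_le_one_right hN hr1).trans hs

theorem bijective_of_mem_levelMaps {N : ℝ} {φ : ℝ → ℝ} (h : φ ∈ levelMaps N) :
    φ.Bijective := by
  obtain ⟨h1, h2, h3⟩ := h
  refine ⟨h1.injective, h2.surjective ?_ ?_⟩
  · refine tendsto_id.congr' ?_
    filter_upwards [eventually_ge_atTop N] with s hs
    exact (h3 s (.inr hs)).symm
  · refine tendsto_id.congr' ?_
    filter_upwards [eventually_le_atBot 0] with s hs
    exact (h3 s (.inl hs)).symm

/-- The delicate points are those with `r x = 0`, where `z / r` is uncontrolled; there the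
correction is at most `|r| * N`, because level maps displace points by at most `N`. -/
theorem continuous_rescale {X : Type*} [TopologicalSpace X] {N : ℝ} (hN : 0 ≤ N) {g : X → ℝ → ℝ}
    (hg : ∀ x, g x ∈ levelMaps N) (hpt : ∀ s, Continuous fun x => g x s) {r : X → ℝ}
    (hr : Continuous r) : Continuous fun p : X × ℝ => rescale (g p.1) (r p.1) p.2 := by
  have hj := continuous_uncurry_of_monotone (fun x => (hg x).1.monotone) (fun x => (hg x).2.1) hpt
  refine continuous_snd.add ?_
  rw [continuous_iff_continuousAt]
  rintro ⟨x, z⟩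
  have hr' : ContinuousAt (fun p : X × ℝ => r p.1) (x, z) := (hr.comp continuous_fst).continuousAt
  by_cases h0 : r x = 0
  · rw [ContinuousAt]
    simp only [h0, zero_mul]
    have hlim : Tendsto (fun p : X × ℝ => |r p.1| * N) (𝓝 (x, z)) (𝓝 0) := by
      have := (hr'.abs.mul_const N).tendsto
      simpa [h0] using this
    refine squeeze_zero_norm (fun p => ?_) hlim
    rw [norm_mul, Real.norm_eq_abs, Real.norm_eq_abs]
    exact mul_le_mul_of_nonneg_left (abs_sub_le_of_mem_levelMaps hN (hg _) _) (abs_nonneg _)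
  · have hd : ContinuousAt (fun p : X × ℝ => p.2 / r p.1) (x, z) :=
      continuousAt_snd.div hr' h0
    refine hr'.mul (ContinuousAt.sub ?_ hd)
    exact ContinuousAt.comp (f := fun p : X × ℝ => (p.1, p.2 / r p.1)) hj.continuousAt
      (continuousAt_fst.prodMk hd)

/-! ### Level maps adapted to two orderings -/

namespace ChordDiagram

variable {ι : Type*} {n : ℕ}

/-- If two orderings agree on a set of chords, there is a level map which moves the layers of these
chords from their positions in the first ordering to those in the second one. -/
theorem exists_levelMap_of_orderings (σ τ : ι ≃ Fin n) (I : Set ι)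
    (hI : ∀ i ∈ I, ∀ j ∈ I, σ i < σ j → τ i < τ j) :
    ∃ φ ∈ levelMaps (n + 1), ∀ i ∈ I, ∀ s : ℝ, |s - ((σ i : ℕ) + 1)| ≤ 1 / 4 →
      φ s = s + ((τ i : ℕ) - (σ i : ℕ)) := by
  have hn : (0 : ℝ) ≤ n := n.cast_nonneg
  have hbound : ∀ k : Fin n, (0 : ℝ) ≤ (k : ℕ) ∧ ((k : ℕ) : ℝ) + 1 ≤ n := fun k =>
    ⟨Nat.cast_nonneg _, by exact_mod_cast k.2⟩
  have hlt : ∀ k l : Fin n, k < l → ((k : ℕ) : ℝ) + 1 ≤ (l : ℕ) := fun k l h => by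
    exact_mod_cast h
  -- Distinct slabs are at least 1/2 apart, and at least 3/4 from the fixed rays since levels run
  -- from 1 to `n`. Gaps change by at most `2 * n`, so their ratios are at most `1 + 4 * n`.
  have far : ∀ d e : ℝ, 1 / 2 ≤ d → 1 / 2 ≤ e → |d - e| ≤ 2 * n →
      d ≤ (1 + 4 * n) * e ∧ e ≤ (1 + 4 * n) * d := by
    intro d e hd he h
    have := abs_le.1 h
    constructor <;> nlinarith
  obtain ⟨φ, h1, h2, h3⟩ := exists_strictMono_continuous_of_graph
    ({p : ℝ × ℝ | p.1 = p.2 ∧ (p.1 ≤ 0 ∨ (n + 1 : ℝ) ≤ p.1)} ∪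
      {p | ∃ i ∈ I, |p.1 - ((σ i : ℕ) + 1)| ≤ 1 / 4 ∧ p.2 = p.1 + ((τ i : ℕ) - (σ i : ℕ))})
    (C := 1 + 4 * n) (by linarith) (by
      rintro ⟨a, a'⟩ hp ⟨b, b'⟩ hq hab
      simp only at hab ⊢
      rcases hp with ⟨rfl : a = a', ha⟩ | ⟨i, hi, ha, rfl : a' = a + _⟩ <;>
      rcases hq with ⟨rfl : b = b', hb⟩ | ⟨j, hj, hb, rfl : b' = b + _⟩
      · constructor <;> nlinarith
      · have hσ := hbound (σ j)
        have hτ := hbound (τ j)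
        have hb := abs_le.1 hb
        simp only at ha hb
        rcases ha with ha | ha
        · refine far _ _ (by linarith) (by linarith) (abs_le.2 ⟨by linarith, by linarith⟩)
        · linarith
      · have hσ := hbound (σ i)
        have hτ := hbound (τ i)
        have ha := abs_le.1 ha
        simp only at ha hb
        rcases hb with hb | hb
        · linarith
        · refine far _ _ (by linarith) (by linarith) (abs_le.2 ⟨by linarith, by linarith⟩)
      · have ha := abs_le.1 ha
        have hb := abs_le.1 hb
        simp only at ha hb
        rcases lt_trichotomy (σ i) (σ j) with h | h | h
        · have u1 := hlt _ _ h
          have u2 := hlt _ _ (hI i hi j hj h)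
          have hσ := hbound (σ i)
          have hτ := hbound (τ i)
          have hσ' := hbound (σ j)
          have hτ' := hbound (τ j)
          refine far _ _ (by linarith) (by linarith) (abs_le.2 ⟨by linarith, by linarith⟩)
        · obtain rfl := σ.injective h
          constructor <;> nlinarith
        · have u1 := hlt _ _ h
          linarith)
  exact ⟨φ, ⟨h1, h2, fun s hs => h3 (s, s) (.inl ⟨rfl, hs⟩)⟩,
    fun i hi s hs => h3 (s, s + ((τ i : ℕ) - (σ i : ℕ))) (.inr ⟨i, hi, hs, rfl⟩)⟩

/-- A continuous family of level maps, parametrized by the plane, which over the strip of each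
chord moves the layer of this chord from its position in the first ordering to that in the second
one. -/
theorem exists_continuous_levelMap {L : ChordDiagram ι} {σ τ : ι ≃ Fin n}
    (hστ : L.directedIncidenceGraph σ = L.directedIncidenceGraph τ) {ε : ℝ}
    (hε : L.IsBandWidth ε) :
    ∃ g : C(ℂ, ℝ → ℝ), ∀ x, g x ∈ levelMaps (n + 1) ∧ ∀ i, x ∈ L.strip ε i → ∀ s : ℝ,
      |s - ((σ i : ℕ) + 1)| ≤ 1 / 4 → g x s = s + ((τ i : ℕ) - (σ i : ℕ)) := by
  refine exists_continuous_forall_mem_convex_of_local_const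
    (t := fun x => {φ : ℝ → ℝ | φ ∈ levelMaps (n + 1) ∧ ∀ i, x ∈ L.strip ε i → ∀ s : ℝ,
      |s - ((σ i : ℕ) + 1)| ≤ 1 / 4 → φ s = s + ((τ i : ℕ) - (σ i : ℕ))}) ?_ ?_
  · rintro x φ ⟨h1, h2⟩ ψ ⟨k1, k2⟩ a b ha hb hab
    refine ⟨convex_levelMaps _ h1 k1 ha hb hab, fun i hi s hs => ?_⟩
    simp only [Pi.add_apply, Pi.smul_apply, smul_eq_mul, h2 i hi s hs, k2 i hi s hs]
    rw [← add_mul, hab, one_mul]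
  · intro x
    obtain ⟨φ, hφ, h⟩ := exists_levelMap_of_orderings σ τ {i | x ∈ L.strip ε i} (by
      intro i hi j hj hlt
      have hij : i ≠ j := by rintro rfl; exact lt_irrefl _ hlt
      have hadj : (L.directedIncidenceGraph σ).Adj i j :=
        ⟨⟨hij, chord_inter_nonempty_of_mem_strip hε hij hi hj⟩, hlt⟩
      rw [hστ] at hadj
      exact hadj.2)
    have : Finite ι := Finite.of_equiv _ σ.symm
    refine ⟨φ, ?_⟩
    -- Points near `x` lie in no further strips, so `φ` meets all conditions there.
    have hev : ∀ᶠ y in 𝓝 x, ∀ i, y ∈ L.strip ε i → x ∈ L.strip ε i := by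
      refine eventually_all.2 fun i => ?_
      by_cases hx : x ∈ L.strip ε i
      · exact Eventually.of_forall fun _ _ => hx
      · filter_upwards [(L.isClosed_strip ε i).isOpen_compl.mem_nhds hx] with y hy hy'
        exact (hy hy').elim
    filter_upwards [hev] with y hy
    exact ⟨hφ, fun i hi => h i (hy i hi)⟩

end ChordDiagram

/-! ### The vertical isotopy -/

/-- A continuous family of level maps gives a compactly supported isotopy of `ℝ³` which moves the
point at level `s` over the point `x` of the disk to level `g x s`. -/
theorem exists_ambientIsotopy_of_levelMaps {N : ℝ} (hN : 0 ≤ N) (g : C(ℂ, ℝ → ℝ))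
    (hg : ∀ x, g x ∈ levelMaps N) :
    ∃ H : AmbientIsotopy S3, ∀ x : ℂ, ‖x‖ ≤ 1 → ∀ s : ℝ,
      H.toHomeo 1 ((x, (1 - ‖x‖ ^ 2) * s) : ℂ × ℝ) = ((x, (1 - ‖x‖ ^ 2) * g x s) : ℂ × ℝ) := by
  -- Truncating at 0 makes the isotopy trivial outside the disk.
  let r : ℂ → ℝ := fun x => max (1 - ‖x‖ ^ 2) 0
  have hr : Continuous r := by fun_prop
  have hr0 : ∀ x, 0 ≤ r x := fun x => le_max_right _ _
  have hr1 : ∀ x, r x ≤ 1 := fun x => max_le (by linarith [sq_nonneg ‖x‖]) zero_le_one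
  let f : unitInterval × ℂ → ℝ → ℝ := fun p => (1 - (p.1 : ℝ)) • id + (p.1 : ℝ) • g p.2
  have hf : ∀ p, f p ∈ levelMaps N := fun p =>
    convex_levelMaps N (id_mem_levelMaps N) (hg p.2) (sub_nonneg.2 p.1.2.2) p.1.2.1 (by ring)
  have hfc : ∀ s, Continuous fun p => f p s := by
    intro s
    have : Continuous fun x => g x s := (continuous_apply s).comp g.continuous
    simp only [f, Pi.add_apply, Pi.smul_apply, smul_eq_mul]
    fun_prop
  have hm : ∀ t x, rescale (f (t, x)) (r x) ∈ levelMaps N := fun t x =>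
    rescale_mem_levelMaps hN (hr0 x) (hr1 x) (hf _)
  obtain ⟨H, hH⟩ := exists_ambientIsotopy_onePoint (X := ℂ × ℝ)
    (fun t p => (p.1, rescale (f (t, p.1)) (r p.1) p.2)) (by
      have h := continuous_rescale hN hf hfc (hr.comp continuous_snd)
      have h' : Continuous fun q : unitInterval × ℂ × ℝ => ((q.1, q.2.1), q.2.2) := by fun_prop
      exact (continuous_fst.comp continuous_snd).prodMk (h.comp h')) (by
      intro t
      refine ⟨fun p q h => ?_, fun q => ?_⟩
      · obtain ⟨h1, h2⟩ := Prod.mk.inj h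
        refine Prod.ext h1 ((bijective_of_mem_levelMaps (hm t p.1)).1 ?_)
        rwa [← h1] at h2
      · obtain ⟨z, hz⟩ := (bijective_of_mem_levelMaps (hm t q.1)).2 q.2
        exact ⟨(q.1, z), Prod.ext rfl hz⟩) (by
      rintro ⟨x, z⟩
      simp [f, rescale])
    ((isCompact_closedBall (0 : ℂ) 1).prod (isCompact_Icc (a := (0 : ℝ)) (b := N))) (by
      rintro t ⟨x, z⟩ hp
      refine Prod.ext rfl ?_
      by_cases hx : ‖x‖ ≤ 1
      · refine (hm t x).2.2 z ?_
        by_contra hcon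
        push Not at hcon
        exact hp ⟨by simpa using hx, hcon.1.le, hcon.2.le⟩
      · have h0 : r x = 0 := max_eq_right (by nlinarith)
        simp [rescale, h0])
  refine ⟨H, fun x hx s => ?_⟩
  have hrx : r x = 1 - ‖x‖ ^ 2 := max_eq_left (by nlinarith [norm_nonneg x])
  rw [hH, ← hrx]
  simp [rescale_mul, f]

/-! ### Bands stay within their strips and slabs -/

namespace ChordDiagram

variable {ι : Type*} {n : ℕ}

theorem abs_twist_le (χ : ℤˣ) {v : ℝ} (hv : v ∈ Set.Icc (-1 : ℝ) 1) (θ : ℝ) :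
    |((χ : ℤ) : ℝ) * (v * Real.sin θ) / 4| ≤ 1 / 4 := by
  have h1 : |((χ : ℤ) : ℝ)| = 1 := by
    rcases Int.units_eq_one_or χ with rfl | rfl <;> simp
  have h2 : |v| * |Real.sin θ| ≤ 1 :=
    mul_le_one₀ (abs_le.2 hv) (abs_nonneg _) (Real.abs_sin_le_one θ)
  rw [abs_div, abs_mul, abs_mul, h1, one_mul, abs_of_pos (by norm_num : (0 : ℝ) < 4)]
  linarith

theorem stripPoint_mem_strip (L : ChordDiagram ι) {ε : ℝ} (hε : 0 ≤ ε) (i : ι) {s v : ℝ}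
    (hs : s ∈ Set.Icc (0 : ℝ) 1) (hv : v ∈ Set.Icc (-1 : ℝ) 1) (θ : ℝ) :
    L.stripPoint i s (ε * (v * Real.cos θ)) ∈ L.strip ε i := by
  refine ⟨(s, ε * (v * Real.cos θ)), ⟨hs, abs_le.1 ?_⟩, rfl⟩
  rw [abs_mul, abs_mul, abs_of_nonneg hε]
  exact mul_le_of_le_one_right hε
    (mul_le_one₀ (abs_le.2 hv) (abs_nonneg _) (Real.abs_cos_le_one θ))

end ChordDiagram

end

/-- Two orderings of a chord diagram with the same directed incidence graph give the same fibered
link with the same fiber, up to ambient isotopy of `S³`. The isotopy ends at a homeomorphism that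
fixes the disk `D` pointwise, so it respects the orientations of the (connected) fibers that extend
the orientation of `D`, and hence the orientations of the links as their boundaries. -/
theorem mainTheorem4 {ι : Type*} {n : ℕ} (L : ChordDiagram ι) (σ τ : ι ≃ Fin n)
    (hστ : L.directedIncidenceGraph σ = L.directedIncidenceGraph τ)
    (ε : ℝ) (hε : L.IsBandWidth ε) (χ : ℤˣ) :
    ∃ H : AmbientIsotopy S3,
      (∀ x ∈ flatDiskS3, H.toHomeo 1 x = x) ∧
      H.toHomeo 1 '' L.fiberSurface σ ε χ = L.fiberSurface τ ε χ ∧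
      H.toHomeo 1 '' L.fiberedLink σ ε χ = L.fiberedLink τ ε χ := by
  obtain ⟨g, hg⟩ := ChordDiagram.exists_continuous_levelMap hστ hε
  obtain ⟨H, hH⟩ := exists_ambientIsotopy_of_levelMaps (by positivity) g fun x => (hg x).1
  have hdisk : ∀ p ∈ flatDisk, H.toHomeo 1 (p : S3) = p := by
    rintro ⟨x, z⟩ ⟨hx, rfl : z = 0⟩
    have h := hH x (by simpa using hx) 0
    rwa [(hg x).1.2.2 0 (.inl le_rfl), mul_zero] at h
  have hband : ∀ i, ∀ s ∈ Set.Icc (0 : ℝ) 1, ∀ v ∈ Set.Icc (-1 : ℝ) 1,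
      H.toHomeo 1 (L.bandPoint ε χ ((σ i : ℕ) + 1) i s v : S3) =
        (L.bandPoint ε χ ((τ i : ℕ) + 1) i s v : S3) := by
    intro i s hs v hv
    unfold ChordDiagram.bandPoint
    rw [hH _ (L.norm_stripPoint_le i hs _),
      (hg _).2 i (L.stripPoint_mem_strip hε.1.le i hs hv _) _
        (by simpa using ChordDiagram.abs_twist_le χ hv _)]
    congr 3
    ring
  have hsurf : H.toHomeo 1 '' L.fiberSurface σ ε χ = L.fiberSurface τ ε χ := by
    unfold ChordDiagram.fiberSurface
    rw [Set.image_union, Set.image_union, Set.image_union, Set.image_iUnion, Set.image_iUnion,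
      Set.image_iUnion]
    congr 1
    · rw [Set.image_image]
      exact Set.image_congr hdisk
    · refine Set.iUnion_congr fun i => ?_
      ext y
      constructor
      · rintro ⟨_, ⟨_, ⟨s, hs, v, hv, rfl⟩, rfl⟩, rfl⟩
        exact ⟨_, ⟨s, hs, v, hv, rfl⟩, (hband i s hs v hv).symm⟩
      · rintro ⟨_, ⟨s, hs, v, hv, rfl⟩, rfl⟩
        exact ⟨_, ⟨_, ⟨s, hs, v, hv, rfl⟩, rfl⟩, hband i s hs v hv⟩
  refine ⟨H, ?_, hsurf, ?_⟩
  · rintro _ ⟨p, hp, rfl⟩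
    exact hdisk p hp
  · rw [ChordDiagram.fiberedLink, ChordDiagram.fiberedLink, image_surfaceBoundary, hsurf]
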